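/- Let $p=(p(n))_{n\in\mathbb N}$ be a probability distribution on $\mathbb N=\{0,1,2,\dots\}$ with $0<p(0)<1$, $p(0)+p(1)<1$ and mean $m=\sum_n n\,p(n)\in(1,\infty)$, and let $\zeta$ be a random variable with distribution $p$. Let $\tau$ be a Galton--Watson tree with offspring distribution $p$, that is, a random locally finite ordered rooted tree such that the number of children of the root has distribution $p$ and, for every $n\ge 1$, conditionally on the root having $n$ children, the sub-trees above these children are independent and distributed as $\tau$. Let $z_n(\tau)$ be the number of vertices of $\tau$ at height $n$, and let $q$ be the smallest root in $[0,1]$ of $\mathbb E[r^\zeta]=r$. Then $q$ is the extinction probability, $\mathbb P(\tau\text{ is finite})=q$; the sequence $z_n(\tau)/m^n$ converges almost surely, as $n\to\infty$, to a finite random variable $W$; and, with $\log^+(r)=\max(\log r,0)$ and $0\log^+(0)=0$, \begin{itemize} \item $\mathbb P(W=0)=q$ if $\mathbb E[\zeta\log^+(\zeta)]<+\infty$; \item $\mathbb P(W=0)=1$ if $\mathbb E[\zeta\log^+(\zeta)]=+\infty$. \end{itemize} -/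

import Mathlib

open MeasureTheory ProbabilityTheory Filter Topology Set
open scoped ENNReal

/-- Locally finite ordered rooted trees in Neveu's formalism: sets of finite words over the
positive integers that contain the empty word, are closed under taking ancestors (prefixes), and
in which every vertex `u` has finitely many children `u1, ..., uk`. -/
@[ext]
structure NeveuTree where
  carrier : Set (List ℕ+)
  nil_mem : [] ∈ carrier
  mem_of_prefix : ∀ u ∈ carrier, ∀ v, v <+: u → v ∈ carrier
  exists_children : ∀ u ∈ carrier, ∃ k : ℕ, ∀ i : ℕ+, u ++ [i] ∈ carrier ↔ (i : ℕ) ≤ k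

namespace NeveuTree

/-- The tree reduced to its root. -/
def rootTree : NeveuTree where
  carrier := {[]}
  nil_mem := rfl
  mem_of_prefix := by
    rintro u rfl v hv
    exact List.prefix_nil.mp hv
  exists_children := by
    rintro u rfl
    exact ⟨0, fun i => by simp⟩

/-- The number of children of the root (a finite set of children, so `ncard` is the true
cardinality). -/
noncomputable def rootDegree (t : NeveuTree) : ℕ := {i : ℕ+ | [i] ∈ t.carrier}.ncard

/-- The set of children of the root is `{1, ..., rootDegree}`. -/
theorem singleton_mem_iff (t : NeveuTree) (i : ℕ+) :
    [i] ∈ t.carrier ↔ (i : ℕ) ≤ t.rootDegree := by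
  obtain ⟨k, hk⟩ := t.exists_children [] t.nil_mem
  have hk' : ∀ i : ℕ+, [i] ∈ t.carrier ↔ (i : ℕ) ≤ k := by simpa using hk
  have h : t.rootDegree = k := by
    have h1 : (fun i : ℕ+ => (i : ℕ)) '' {i : ℕ+ | [i] ∈ t.carrier} = Set.Icc 1 k := by
      ext n
      constructor
      · rintro ⟨i, hi, rfl⟩
        exact ⟨i.pos, (hk' i).1 hi⟩
      · rintro ⟨h1, h2⟩
        exact ⟨⟨n, h1⟩, (hk' _).2 h2, rfl⟩
    rw [rootDegree, ← Set.ncard_image_of_injective _ PNat.coe_injective, h1]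
    simp [Set.ncard_eq_toFinset_card']
  rw [h, hk']

/-- The width `z_h(t)` at level `h`: the number of vertices of length `h` (a finite set). -/
noncomputable def width (h : ℕ) (t : NeveuTree) : ℕ := {u ∈ t.carrier | u.length = h}.ncard

open Classical in
/-- The sub-tree of `t` above `u`, that is `{v | uv ∈ t}`, for `u ∈ t`. When `u ∉ t` that set is
not a tree, and the value is set to the tree reduced to its root. -/
noncomputable def subtree (u : List ℕ+) (t : NeveuTree) : NeveuTree :=
  if hu : u ∈ t.carrier then
    { carrier := {v | u ++ v ∈ t.carrier}
      nil_mem := by simpa using hu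
      mem_of_prefix := fun v hv w hw =>
        t.mem_of_prefix _ hv _ ((List.prefix_append_right_inj u).mpr hw)
      exists_children := fun v hv => by
        simpa only [Set.mem_ofPred_eq, ← List.append_assoc] using t.exists_children _ hv }
  else rootTree

/-- The restriction `r_h(t)` of `t` to the vertices of height at most `h`. -/
def restrict (h : ℕ) (t : NeveuTree) : Set (List ℕ+) := {u ∈ t.carrier | u.length ≤ h}

/-- The topology of the distance `d(t, t') = 2 ^ (-sup {h | r_h(t) = r_h(t')})`, whose balls
around `t` are the sets `{t' | r_h(t') = r_h(t)}`. -/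
instance : TopologicalSpace NeveuTree where
  IsOpen s := ∀ t ∈ s, ∃ h : ℕ, ∀ t' : NeveuTree, restrict h t' = restrict h t → t' ∈ s
  isOpen_univ := fun _ _ => ⟨0, fun _ _ => trivial⟩
  isOpen_inter := by
    intro s₁ s₂ h₁ h₂ t ht
    obtain ⟨a, ha⟩ := h₁ t ht.1
    obtain ⟨b, hb⟩ := h₂ t ht.2
    have key : ∀ c d : ℕ, c ≤ d → ∀ t' : NeveuTree,
        restrict d t' = restrict d t → restrict c t' = restrict c t := by
      intro c d hcd t' he
      ext u
      have hu := Set.ext_iff.mp he u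
      simp only [restrict, Set.mem_ofPred_eq] at hu ⊢
      constructor
      · rintro ⟨h1, h2⟩
        exact ⟨(hu.1 ⟨h1, h2.trans hcd⟩).1, h2⟩
      · rintro ⟨h1, h2⟩
        exact ⟨(hu.2 ⟨h1, h2.trans hcd⟩).1, h2⟩
    exact ⟨max a b, fun t' he =>
      ⟨ha t' (key _ _ (le_max_left a b) t' he), hb t' (key _ _ (le_max_right a b) t' he)⟩⟩
  isOpen_sUnion := by
    intro S hS t ht
    obtain ⟨s, hs, hts⟩ := ht
    obtain ⟨h, hh⟩ := hS s hs t hts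
    exact ⟨h, fun t' he => ⟨s, hs, hh t' he⟩⟩

/-- The Borel sigma-field. -/
instance : MeasurableSpace NeveuTree := borel NeveuTree

instance : BorelSpace NeveuTree := ⟨rfl⟩

end NeveuTree

/-- `τ` has the branching property: for `n ≥ 1`, conditionally on the root having `n` children
(when this event has positive probability), the sub-trees above these children are independent
and distributed as `τ`. The children are the vertices `1, ..., n`. -/
def HasBranchingProperty {Ω : Type*} [MeasurableSpace Ω] (P : Measure Ω)
    (τ : Ω → NeveuTree) : Prop :=
  ∀ n : ℕ, 1 ≤ n → P {ω | (τ ω).rootDegree = n} ≠ 0 →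
    iIndepFun (fun (i : Fin n) ω => (τ ω).subtree [Nat.succPNat i])
      (cond P {ω | (τ ω).rootDegree = n}) ∧
    ∀ i : Fin n, IdentDistrib (fun ω => (τ ω).subtree [Nat.succPNat i]) τ
      (cond P {ω | (τ ω).rootDegree = n}) P

/-- `τ` is a Galton-Watson tree with offspring distribution `p`. -/
structure IsGWTree {Ω : Type*} [MeasurableSpace Ω] (P : Measure Ω) (p : PMF ℕ)
    (τ : Ω → NeveuTree) : Prop where
  measurable : Measurable τ
  branching : HasBranchingProperty P τ
  rootDegree_law : ∀ n : ℕ, P {ω | (τ ω).rootDegree = n} = p n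

/-- The mean `m = E[ζ]` of the offspring distribution, in `[0, ∞]`. -/
noncomputable def offspringMean (p : PMF ℕ) : ℝ≥0∞ := ∑' n : ℕ, p n * n

/-- `E[ζ log⁺ ζ]`, in `[0, ∞]`. -/
noncomputable def offspringLogMoment (p : PMF ℕ) : ℝ≥0∞ :=
  ∑' n : ℕ, p n * ENNReal.ofReal (n * max (Real.log n) 0)

/-- The generating function `g(r) = E[r ^ ζ]`, for `r ∈ [0, 1]`. -/
noncomputable def offspringGenFun (p : PMF ℕ) (r : ℝ) : ℝ := ∑' n : ℕ, (p n).toReal * r ^ n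

/-- The renormalized process `W_n(t) = z_n(t) / m ^ n`. -/
noncomputable def normalizedWidth (p : PMF ℕ) (n : ℕ) (t : NeveuTree) : ℝ :=
  (t.width n : ℝ) / (offspringMean p).toReal ^ n

/-!
The proof works with the law `ν` of the width sequence `n ↦ z_n(τ)` on `ℕ → ℕ`. The branching
property says that `ν` solves the recursive distributional equation `IsBranchingLaw`: with
probability `p d`, the sequence is `1` followed by the sum of `d` independent copies of itself.
This equation alone gives the generating function `g^[n]` of `z_n`
(`IsBranchingLaw.lintegral_pow`) and the martingale property of `z_n / m ^ n`
(`IsBranchingLaw.lintegral_mul_succ`), hence the almost sure convergence to a limit `W`.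

The tree is finite if and only if some `z_n` vanishes, so the extinction probability is the limit
of `g^[n] 0`, which is the least fixed point `q` of `g` (`exists_isLeast_root`).

For the dichotomy, write `1 - g (1 - x) = x * (m - B x)`, where `B` is nondecreasing and vanishes
at `0`. Expanding `B` term by term shows that `E[ζ log⁺ ζ]` is finite if and only if
`∑ k, B (c * m ^ (-k))` is finite for some, equivalently every, `c ∈ (0, 1]`
(`tsum_genDefect_lt_top`, `offspringLogMoment_lt_top`). The Laplace transforms `φ_n` of
`z_n / m ^ n` satisfy `φ_{n + 1} l = g (φ_n (l / m))`, that is, `ψ_n = 1 - φ_n` satisfies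
`ψ_{n + 1} l = ψ_n (l / m) * (m - B (ψ_n (l / m)))`, and `ψ_n l ≤ l`.
- If the sum is finite, iterating this recursion bounds `ψ_n l` below uniformly in `n`
  (`exists_le_laplaceDefect`), so the Laplace transform `φ` of `W` is not constant.
- If `ψ = 1 - φ` is positive at `1`, iterating `ψ l = ψ (l / m) * (m - B (ψ (l / m)))` bounds the
  product of the factors `1 - B (ψ (m ^ (-k))) / m` below, so that the sum is finite
  (`offspringLogMoment_lt_top_of_solution`).

Finally `P(W = 0)` is the limit of `φ (m ^ k)`, hence a fixed point of `g`. Strict convexity leaves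
only `q` and `1`, and the value is `1` exactly when `φ` is constant
(`IsBranchingLaw.measure_limit_eq_zero`).
-/

/-! ### Widths of trees -/

namespace NeveuTree

theorem mem_carrier_of_append {t : NeveuTree} {u v : List ℕ+} (h : u ++ v ∈ t.carrier) :
    u ∈ t.carrier :=
  t.mem_of_prefix _ h _ (List.prefix_append u v)

theorem mem_subtree_singleton_iff {t : NeveuTree} {i : ℕ+} (hi : [i] ∈ t.carrier)
    (v : List ℕ+) : v ∈ (t.subtree [i]).carrier ↔ i :: v ∈ t.carrier := by
  simp [subtree, hi]

/-- The vertices of `t` at height `h`. -/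
def level (h : ℕ) (t : NeveuTree) : Set (List ℕ+) := {u ∈ t.carrier | u.length = h}

theorem level_zero (t : NeveuTree) : level 0 t = {[]} := by
  ext u
  simp only [level, Set.mem_ofPred_eq, List.length_eq_zero_iff, Set.mem_singleton_iff]
  exact ⟨fun h => h.2, fun h => ⟨h ▸ t.nil_mem, h⟩⟩

theorem level_succ (h : ℕ) (t : NeveuTree) :
    level (h + 1) t = ⋃ i : Fin t.rootDegree,
      List.cons (Nat.succPNat i) '' level h (t.subtree [Nat.succPNat i]) := by
  ext u
  simp only [level, Set.mem_ofPred_eq, Set.mem_iUnion, Set.mem_image]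
  constructor
  · rintro ⟨hu, hl⟩
    obtain ⟨i, v, rfl⟩ := List.exists_cons_of_length_eq_add_one hl
    have hi : [i] ∈ t.carrier := mem_carrier_of_append (v := v) (by simpa using hu)
    have hle := (t.singleton_mem_iff i).1 hi
    have hpos := i.pos
    refine ⟨⟨i.natPred, by simp only [PNat.natPred]; omega⟩, v, ?_⟩
    rw [PNat.succPNat_natPred, mem_subtree_singleton_iff hi]
    exact ⟨⟨hu, by simpa using hl⟩, rfl⟩
  · rintro ⟨i, v, ⟨hv, hl⟩, rfl⟩
    have hi : [Nat.succPNat i] ∈ t.carrier := (t.singleton_mem_iff _).2 (by simp)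
    exact ⟨(mem_subtree_singleton_iff hi v).1 hv, by simp [hl]⟩

theorem finite_level (h : ℕ) (t : NeveuTree) : (level h t).Finite := by
  induction h generalizing t with
  | zero => rw [level_zero]; exact Set.finite_singleton _
  | succ h ih =>
    rw [level_succ]
    exact Set.finite_iUnion fun i => (ih _).image _

theorem width_zero (t : NeveuTree) : t.width 0 = 1 := by
  change (level 0 t).ncard = 1
  rw [level_zero, Set.ncard_singleton]

theorem width_succ (h : ℕ) (t : NeveuTree) :
    t.width (h + 1) = ∑ i : Fin t.rootDegree, (t.subtree [Nat.succPNat i]).width h := by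
  change (level (h + 1) t).ncard = _
  rw [level_succ, Set.ncard_iUnion_of_finite (fun i => (finite_level _ _).image _),
    finsum_eq_sum_of_fintype]
  · refine Finset.sum_congr rfl fun i _ => ?_
    exact Set.ncard_image_of_injective _ List.cons_injective
  · intro i j hij
    refine Set.disjoint_left.2 ?_
    rintro _ ⟨v, -, rfl⟩ ⟨w, -, hw⟩
    have := (List.cons.inj hw).1
    exact hij (Fin.ext (Nat.succPNat_injective this.symm))

theorem width_one (t : NeveuTree) : t.width 1 = t.rootDegree := by
  simp [width_succ, width_zero]

theorem width_eq_zero_iff (h : ℕ) (t : NeveuTree) : t.width h = 0 ↔ level h t = ∅ :=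
  Set.ncard_eq_zero (finite_level h t)

theorem width_eq_zero_of_le {h k : ℕ} (hk : h ≤ k) {t : NeveuTree} (h0 : t.width h = 0) :
    t.width k = 0 := by
  rw [width_eq_zero_iff, Set.eq_empty_iff_forall_notMem] at h0 ⊢
  rintro u ⟨hu, hl⟩
  exact h0 (u.take h) ⟨t.mem_of_prefix u hu _ (List.take_prefix h u), by simp [hl, hk]⟩

theorem finite_carrier_iff (t : NeveuTree) : t.carrier.Finite ↔ ∃ h, t.width h = 0 := by
  constructor
  · intro hf
    obtain ⟨b, hb⟩ := (hf.image List.length).bddAbove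
    refine ⟨b + 1, (width_eq_zero_iff _ _).2 (Set.eq_empty_iff_forall_notMem.2 ?_)⟩
    rintro u ⟨hu, hl⟩
    have := hb (Set.mem_image_of_mem List.length hu)
    omega
  · rintro ⟨h, h0⟩
    refine (Set.finite_iUnion fun k : Fin h => finite_level k t).subset fun u hu => ?_
    refine Set.mem_iUnion.2 ⟨⟨u.length, ?_⟩, hu, rfl⟩
    by_contra hlt
    have := (width_eq_zero_iff _ _).1 (width_eq_zero_of_le (not_lt.1 hlt) h0)
    exact (Set.eq_empty_iff_forall_notMem.1 this) u ⟨hu, rfl⟩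

theorem level_eq_of_restrict_eq {h : ℕ} {t t' : NeveuTree} (he : restrict h t' = restrict h t) :
    level h t' = level h t := by
  ext u
  have := Set.ext_iff.1 he u
  simp only [restrict, Set.mem_ofPred_eq] at this
  simp only [level, Set.mem_ofPred_eq]
  constructor
  · rintro ⟨h1, h2⟩
    exact ⟨(this.1 ⟨h1, h2.le⟩).1, h2⟩
  · rintro ⟨h1, h2⟩
    exact ⟨(this.2 ⟨h1, h2.le⟩).1, h2⟩

/-- Widths are locally constant, hence Borel. -/
theorem measurable_width (h : ℕ) : Measurable (width h) := by
  intro s _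
  refine IsOpen.measurableSet fun t ht => ⟨h, fun t' he => ?_⟩
  have : width h t' = width h t := congrArg Set.ncard (level_eq_of_restrict_eq he)
  rwa [Set.mem_preimage, this]

theorem measurable_rootDegree : Measurable rootDegree := by
  simpa only [funext width_one] using measurable_width 1

/-- The sequence of widths of a tree. -/
noncomputable def widthSeq (t : NeveuTree) : ℕ → ℕ := fun n => t.width n

theorem measurable_widthSeq : Measurable widthSeq :=
  measurable_pi_lambda _ measurable_width

end NeveuTree

/-! ### The law of the width sequence -/

/-- The width sequence of a tree whose root has `d` children, the sub-trees above which have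
width sequences `x 0, ..., x (d - 1)`. -/
def branchSum {d : ℕ} (x : Fin d → ℕ → ℕ) : ℕ → ℕ
  | 0 => 1
  | n + 1 => ∑ i, x i n

theorem measurable_branchSum (d : ℕ) : Measurable (branchSum (d := d)) := by
  refine measurable_pi_lambda _ fun n => ?_
  cases n with
  | zero => exact measurable_const
  | succ n =>
    exact Finset.measurable_sum _ fun i _ =>
      (measurable_pi_apply n).comp (measurable_pi_apply i)

theorem NeveuTree.widthSeq_eq_branchSum {t : NeveuTree} {d : ℕ} (hd : t.rootDegree = d) :
    t.widthSeq = branchSum fun i : Fin d => (t.subtree [Nat.succPNat i]).widthSeq := by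
  subst hd
  ext n
  cases n with
  | zero => exact t.width_zero
  | succ n => exact t.width_succ n

/-- `ν` is a law on sequences of generation sizes that satisfies the recursive distributional
equation of Galton-Watson processes: a sequence drawn from `ν` is distributed as the
`branchSum` of `d` independent sequences drawn from `ν`, where `d` has law `p`. -/
def IsBranchingLaw (p : PMF ℕ) (ν : Measure (ℕ → ℕ)) : Prop :=
  ∀ f : (ℕ → ℕ) → ℝ≥0∞, Measurable f →
    ∫⁻ x, f x ∂ν = ∑' d : ℕ, p d * ∫⁻ x, f (branchSum x) ∂(Measure.pi fun _ : Fin d => ν)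

/-- Given that the root has `d` children, the width sequences of the sub-trees are independent,
with the law of the width sequence of `τ`. The case `d = 0` does not use the branching
property. -/
theorem setLIntegral_rootDegree {Ω : Type*} [MeasurableSpace Ω] {P : Measure Ω}
    [IsProbabilityMeasure P] {p : PMF ℕ} {τ : Ω → NeveuTree} (hτ : IsGWTree P p τ)
    {f : (ℕ → ℕ) → ℝ≥0∞} (hf : Measurable f) (d : ℕ) :
    ∫⁻ ω in {ω | (τ ω).rootDegree = d}, f (τ ω).widthSeq ∂P =
      p d * ∫⁻ x, f (branchSum x)
        ∂(Measure.pi fun _ : Fin d => P.map fun ω => (τ ω).widthSeq) := by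
  set E : Set Ω := {ω | (τ ω).rootDegree = d} with hE
  have hEm : MeasurableSet E :=
    (NeveuTree.measurable_rootDegree.comp hτ.measurable) (measurableSet_singleton d)
  rw [← hτ.rootDegree_law d]
  by_cases h0 : P E = 0
  · rw [setLIntegral_measure_zero _ _ h0, ← hE, h0, zero_mul]
  have : IsProbabilityMeasure (cond P E) := cond_isProbabilityMeasure h0
  let Y : Fin d → Ω → ℕ → ℕ := fun i ω => ((τ ω).subtree [Nat.succPNat i]).widthSeq
  have hY : ∀ i, AEMeasurable (Y i) (cond P E) ∧
      (cond P E).map (Y i) = P.map fun ω => (τ ω).widthSeq := by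
    intro i
    have hid := ((hτ.branching d (by have := i.pos; omega) h0).2 i).comp
      NeveuTree.measurable_widthSeq
    exact ⟨hid.aemeasurable_fst, hid.map_eq⟩
  have hind : iIndepFun Y (cond P E) := by
    rcases Nat.eq_zero_or_pos d with rfl | hd
    · exact iIndepFun.of_subsingleton
    · exact (hτ.branching d hd h0).1.comp _ fun _ => NeveuTree.measurable_widthSeq
  have hmap := (iIndepFun_iff_map_fun_eq_pi_map fun i => (hY i).1).1 hind
  simp only [fun i => (hY i).2] at hmap
  have hres : P.restrict E = P E • cond P E := by
    rw [ProbabilityTheory.cond, smul_smul, ENNReal.mul_inv_cancel h0 (measure_ne_top _ _), one_smul]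
  rw [setLIntegral_congr_fun hEm
      (g := fun ω => f (branchSum fun i => Y i ω))
      (fun ω hω => congrArg f (NeveuTree.widthSeq_eq_branchSum hω)),
    hres, lintegral_smul_measure, ← hmap, smul_eq_mul]
  exact congrArg (P E * ·) (lintegral_map' (hf.comp (measurable_branchSum d)).aemeasurable
    (aemeasurable_pi_lambda _ fun i => (hY i).1)).symm

/-- The law of the width sequence of a Galton-Watson tree solves the recursive distributional
equation: this is the branching property, read on widths. -/
theorem IsGWTree.isBranchingLaw {Ω : Type*} [MeasurableSpace Ω] {P : Measure Ω}
    [IsProbabilityMeasure P] {p : PMF ℕ} {τ : Ω → NeveuTree} (hτ : IsGWTree P p τ) :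
    IsBranchingLaw p (P.map fun ω => (τ ω).widthSeq) := by
  intro f hf
  have hw : Measurable fun ω => (τ ω).widthSeq :=
    NeveuTree.measurable_widthSeq.comp hτ.measurable
  rw [lintegral_map hf hw]
  have hU : (⋃ d : ℕ, {ω | (τ ω).rootDegree = d}) = Set.univ := by
    ext ω; simp
  have hE : ∀ d, MeasurableSet {ω | (τ ω).rootDegree = d} := fun d =>
    (NeveuTree.measurable_rootDegree.comp hτ.measurable) (measurableSet_singleton d)
  rw [← setLIntegral_univ, ← hU, lintegral_iUnion hE]
  · exact tsum_congr fun d => setLIntegral_rootDegree hτ hf d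
  · intro a b hab
    refine Set.disjoint_left.2 fun ω ha hb => hab ?_
    exact (show (τ ω).rootDegree = a from ha).symm.trans hb

/-! ### The offspring generating function -/

section GenFun

variable (p : PMF ℕ)

theorem summable_pmf : Summable fun n => (p n).toReal :=
  ENNReal.summable_toReal p.tsum_coe_ne_top

theorem tsum_pmf : ∑' n, (p n).toReal = 1 := by
  rw [← ENNReal.tsum_toReal_eq p.apply_ne_top, p.tsum_coe, ENNReal.toReal_one]

theorem offspringGenFun_term_nonneg {r : ℝ} (hr : r ∈ Set.Icc (0 : ℝ) 1) (n : ℕ) :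
    0 ≤ (p n).toReal * r ^ n :=
  mul_nonneg ENNReal.toReal_nonneg (pow_nonneg hr.1 n)

theorem offspringGenFun_term_le {r : ℝ} (hr : r ∈ Set.Icc (0 : ℝ) 1) (n : ℕ) :
    (p n).toReal * r ^ n ≤ (p n).toReal :=
  mul_le_of_le_one_right ENNReal.toReal_nonneg (pow_le_one₀ hr.1 hr.2)

theorem summable_offspringGenFun {r : ℝ} (hr : r ∈ Set.Icc (0 : ℝ) 1) :
    Summable fun n => (p n).toReal * r ^ n :=
  Summable.of_nonneg_of_le (offspringGenFun_term_nonneg p hr) (offspringGenFun_term_le p hr)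
    (summable_pmf p)

theorem offspringGenFun_mapsTo :
    Set.MapsTo (offspringGenFun p) (Set.Icc 0 1) (Set.Icc 0 1) := fun _ hr =>
  ⟨tsum_nonneg (offspringGenFun_term_nonneg p hr),
    ((summable_offspringGenFun p hr).tsum_le_tsum (offspringGenFun_term_le p hr)
      (summable_pmf p)).trans_eq (tsum_pmf p)⟩

theorem offspringGenFun_one : offspringGenFun p 1 = 1 := by
  simp [offspringGenFun, tsum_pmf]

theorem offspringGenFun_monotoneOn : MonotoneOn (offspringGenFun p) (Set.Icc 0 1) :=
  fun _ hr _ hs hrs => (summable_offspringGenFun p hr).tsum_le_tsum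
    (fun n => mul_le_mul_of_nonneg_left (pow_le_pow_left₀ hr.1 hrs n) ENNReal.toReal_nonneg)
    (summable_offspringGenFun p hs)

theorem offspringGenFun_continuousOn : ContinuousOn (offspringGenFun p) (Set.Icc 0 1) := by
  refine continuousOn_tsum (fun n => by fun_prop) (summable_pmf p) fun n r hr => ?_
  rw [Real.norm_of_nonneg (offspringGenFun_term_nonneg p hr n)]
  exact offspringGenFun_term_le p hr n

theorem iterate_offspringGenFun_mem (n : ℕ) {r : ℝ} (hr : r ∈ Set.Icc (0 : ℝ) 1) :
    (offspringGenFun p)^[n] r ∈ Set.Icc (0 : ℝ) 1 :=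
  (offspringGenFun_mapsTo p).iterate n hr

theorem ofReal_offspringGenFun {r : ℝ} (hr : r ∈ Set.Icc (0 : ℝ) 1) :
    ENNReal.ofReal (offspringGenFun p r) = ∑' n, p n * ENNReal.ofReal r ^ n := by
  rw [offspringGenFun, ENNReal.ofReal_tsum_of_nonneg (offspringGenFun_term_nonneg p hr)
    (summable_offspringGenFun p hr)]
  refine tsum_congr fun n => ?_
  rw [ENNReal.ofReal_mul ENNReal.toReal_nonneg, ENNReal.ofReal_toReal (p.apply_ne_top n),
    ENNReal.ofReal_pow hr.1]

end GenFun

/-! ### Generation sizes: generating functions and the martingale -/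

section BranchingLaw

variable {p : PMF ℕ} {ν : Measure (ℕ → ℕ)} [IsProbabilityMeasure ν]

theorem lintegral_pi_eval {d : ℕ} (i : Fin d) {f : (ℕ → ℕ) → ℝ≥0∞} (hf : Measurable f) :
    ∫⁻ x, f (x i) ∂(Measure.pi fun _ : Fin d => ν) = ∫⁻ y, f y ∂ν :=
  (measurePreserving_eval (fun _ : Fin d => ν) i).lintegral_comp hf

theorem lintegral_pi_prod {d : ℕ} {f : (ℕ → ℕ) → ℝ≥0∞} (hf : Measurable f) :
    ∫⁻ x, ∏ i, f (x i) ∂(Measure.pi fun _ : Fin d => ν) = (∫⁻ y, f y ∂ν) ^ d := by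
  have hind : iIndepFun (fun (i : Fin d) (x : Fin d → ℕ → ℕ) => f (x i))
      (Measure.pi fun _ : Fin d => ν) :=
    iIndepFun_pi (X := fun _ : Fin d => f) fun _ => hf.aemeasurable
  rw [lintegral_prod_eq_prod_lintegral_of_indepFun _ _ hind
    fun i => hf.comp (measurable_pi_apply i)]
  simp [lintegral_pi_eval _ hf]

/-- The size of generation `n` has generating function `g^[n]`, where `g` is that of the
offspring distribution. -/
theorem IsBranchingLaw.lintegral_pow (h : IsBranchingLaw p ν) {s : ℝ}
    (hs : s ∈ Set.Icc (0 : ℝ) 1) (n : ℕ) :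
    ∫⁻ x, ENNReal.ofReal s ^ x n ∂ν = ENNReal.ofReal ((offspringGenFun p)^[n] s) := by
  have hm : ∀ k : ℕ, Measurable fun x : ℕ → ℕ => ENNReal.ofReal s ^ x k := fun k =>
    (measurable_of_countable fun j : ℕ => ENNReal.ofReal s ^ j).comp (measurable_pi_apply k)
  induction n with
  | zero => rw [h _ (hm 0)]; simp [branchSum, ENNReal.tsum_mul_right]
  | succ n ih =>
    rw [h _ (hm (n + 1)), Function.iterate_succ_apply',
      ofReal_offspringGenFun p (iterate_offspringGenFun_mem p n hs)]
    refine tsum_congr fun d => ?_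
    rw [← ih, ← lintegral_pi_prod (hm n)]
    simp [branchSum, Finset.prod_pow_eq_pow_sum]

theorem measurable_eval_ennreal (n : ℕ) : Measurable fun x : ℕ → ℕ => (x n : ℝ≥0∞) :=
  (measurable_of_countable fun j : ℕ => (j : ℝ≥0∞)).comp (measurable_pi_apply n)

/-- The martingale property of the generation sizes: the mean of generation `n + 1`, given the
first `n` generations, is `m` times the size of generation `n`. The proof is by induction on `n`;
given the root degree, the size of generation `n + 1` is a sum over the sub-trees above the
children, and all but one of these sub-trees can be frozen. -/
theorem IsBranchingLaw.lintegral_mul_succ (h : IsBranchingLaw p ν) (n : ℕ)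
    {F : (ℕ → ℕ) → ℝ≥0∞} (hF : Measurable F)
    (hdep : ∀ x y : ℕ → ℕ, (∀ k ≤ n, x k = y k) → F x = F y) :
    ∫⁻ x, F x * x (n + 1) ∂ν = offspringMean p * ∫⁻ x, F x * x n ∂ν := by
  have hFm : ∀ {F : (ℕ → ℕ) → ℝ≥0∞}, Measurable F → ∀ k : ℕ,
      Measurable fun x : ℕ → ℕ => F x * x k := fun hF k => hF.mul (measurable_eval_ennreal k)
  have hFb : ∀ {F : (ℕ → ℕ) → ℝ≥0∞}, Measurable F → ∀ (k d : ℕ) (i : Fin d),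
      Measurable fun x : Fin d → ℕ → ℕ => F (branchSum x) * x i k := fun hF k d i =>
    (hF.comp (measurable_branchSum d)).mul
      ((measurable_eval_ennreal k).comp (measurable_pi_apply i))
  induction n generalizing F with
  | zero =>
    have hC : ∀ {d : ℕ} (x : Fin d → ℕ → ℕ), F (branchSum x) = F fun _ => 1 :=
      fun x => hdep _ _ fun k hk => by simp [Nat.le_zero.1 hk, branchSum]
    have hev : ∀ {d : ℕ} (i : Fin d), Measurable fun x : Fin d → ℕ → ℕ => (x i 0 : ℝ≥0∞) :=
      fun i => (measurable_eval_ennreal 0).comp (measurable_pi_apply i)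
    have h1 : ∫⁻ x, (x 0 : ℝ≥0∞) ∂ν = 1 := by
      rw [h _ (measurable_eval_ennreal 0)]
      simp [branchSum]
    rw [h _ (hFm hF _), h _ (hFm hF _)]
    simp only [hC, branchSum, Nat.cast_sum, Nat.cast_one, mul_one, lintegral_const, measure_univ]
    rw [ENNReal.tsum_mul_right, p.tsum_coe, one_mul, offspringMean, ← ENNReal.tsum_mul_right]
    refine tsum_congr fun d => ?_
    rw [lintegral_const_mul _ (Finset.measurable_sum _ fun i _ => hev i),
      lintegral_finsetSum _ fun i _ => hev i]
    simp only [lintegral_pi_eval _ (measurable_eval_ennreal 0), h1]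
    simp [mul_assoc, mul_comm, mul_left_comm]
  | succ n ih =>
    have key : ∀ (d : ℕ) (i : Fin d),
        ∫⁻ x, F (branchSum x) * x i (n + 1) ∂(Measure.pi fun _ : Fin d => ν) =
          ∫⁻ x, offspringMean p * (F (branchSum x) * x i n)
            ∂(Measure.pi fun _ : Fin d => ν) := by
      intro d i
      refine lintegral_eq_of_lmarginal_eq {i} (hFb hF _ d i) ((hFb hF _ d i).const_mul _) ?_
      rw [lmarginal_singleton, lmarginal_singleton]
      ext x
      have hFx : Measurable fun y => F (branchSum (Function.update x i y)) :=
        (hF.comp (measurable_branchSum d)).comp (measurable_update x)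
      simp only [Function.update_self]
      rw [lintegral_const_mul _ (hFm hFx n), ih hFx]
      intro y z hyz
      refine hdep _ _ fun k hk => ?_
      cases k with
      | zero => rfl
      | succ k =>
        refine Finset.sum_congr rfl fun j _ => ?_
        rcases eq_or_ne j i with rfl | hj
        · simpa using hyz k (by omega)
        · simp [hj]
    have hexp : ∀ (d k : ℕ),
        ∫⁻ x, F (branchSum x) * (branchSum x (k + 1) : ℕ) ∂(Measure.pi fun _ : Fin d => ν) =
          ∑ i, ∫⁻ x, F (branchSum x) * x i k ∂(Measure.pi fun _ : Fin d => ν) := by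
      intro d k
      rw [← lintegral_finsetSum _ fun i _ => hFb hF k d i]
      simp [branchSum, Finset.mul_sum]
    rw [h _ (hFm hF _), h _ (hFm hF _),
      ← ENNReal.tsum_mul_left]
    refine tsum_congr fun d => ?_
    rw [hexp, hexp, mul_left_comm]
    congr 1
    rw [Finset.mul_sum]
    refine Finset.sum_congr rfl fun i _ => ?_
    rw [key, lintegral_const_mul _ (hFb hF n d i)]

theorem IsBranchingLaw.lintegral_eval (h : IsBranchingLaw p ν) (n : ℕ) :
    ∫⁻ x, (x n : ℝ≥0∞) ∂ν = offspringMean p ^ n := by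
  induction n with
  | zero => rw [h _ (measurable_eval_ennreal 0)]; simp [branchSum]
  | succ n ih =>
    have := h.lintegral_mul_succ n (F := fun _ => 1) measurable_const fun _ _ _ => rfl
    simpa [ih, pow_succ'] using this

/-- The generation sizes, renormalized by their means. -/
noncomputable def normalizedSize (m : ℝ) (n : ℕ) (x : ℕ → ℕ) : ℝ := (x n : ℝ) / m ^ n

theorem measurable_eval_real (n : ℕ) : Measurable fun x : ℕ → ℕ => (x n : ℝ) :=
  (measurable_of_countable fun j : ℕ => (j : ℝ)).comp (measurable_pi_apply n)

theorem measurable_normalizedSize (m : ℝ) (n : ℕ) : Measurable (normalizedSize m n) :=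
  (measurable_eval_real n).div_const _

theorem setIntegral_eval {μ : Measure (ℕ → ℕ)} (n : ℕ) (s : Set (ℕ → ℕ)) :
    ∫ x in s, (x n : ℝ) ∂μ = (∫⁻ x in s, (x n : ℝ≥0∞) ∂μ).toReal := by
  rw [← integral_toReal (measurable_eval_ennreal n).aemeasurable (by simp)]
  simp

theorem IsBranchingLaw.integrable_eval (h : IsBranchingLaw p ν) (hm : offspringMean p < ∞)
    (n : ℕ) : Integrable (fun x : ℕ → ℕ => (x n : ℝ)) ν := by
  refine ⟨(measurable_eval_real n).aestronglyMeasurable, ?_⟩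
  rw [hasFiniteIntegral_iff_ofReal (ae_of_all _ fun x => Nat.cast_nonneg _)]
  simpa [h.lintegral_eval n] using ENNReal.pow_lt_top hm

theorem IsBranchingLaw.martingale (h : IsBranchingLaw p ν) (hm0 : offspringMean p ≠ 0)
    (hm : offspringMean p < ∞) :
    Martingale (normalizedSize (offspringMean p).toReal)
      (Filtration.piLE (X := fun _ : ℕ => ℕ)) ν := by
  have hpos := ENNReal.toReal_pos hm0 hm.ne
  refine martingale_of_setIntegral_eq_succ (fun n => ?_)
    (fun n => (h.integrable_eval hm n).div_const _) fun n s hs => ?_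
  · refine Measurable.stronglyMeasurable ?_
    have h1 : Measurable fun y : (∀ i : Set.Iic n, ℕ) =>
        (y ⟨n, Set.mem_Iic.2 le_rfl⟩ : ℝ) / (offspringMean p).toReal ^ n :=
      ((measurable_of_countable fun j : ℕ => (j : ℝ)).comp (measurable_pi_apply _)).div_const _
    exact h1.comp (comap_measurable _)
  · have hs' := Filtration.piLE.le n s hs
    obtain ⟨t, -, rfl⟩ := hs
    set s := Preorder.restrictLe (π := fun _ : ℕ => ℕ) n ⁻¹' t
    have hkey := h.lintegral_mul_succ n (F := s.indicator 1) (measurable_one.indicator hs')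
      (fun x y hxy => by
        have : Preorder.restrictLe (π := fun _ : ℕ => ℕ) n x = Preorder.restrictLe n y := by
          ext k
          exact hxy k k.2
        have hmem : x ∈ s ↔ y ∈ s := by simp only [s, Set.mem_preimage, this]
        by_cases hx : x ∈ s
        · simp [hx, hmem.1 hx]
        · have hy : y ∉ s := fun hy => hx (hmem.2 hy)
          simp [hx, hy])
    have hind : ∀ k : ℕ, ∫⁻ x, s.indicator 1 x * (x k : ℝ≥0∞) ∂ν = ∫⁻ x in s, (x k) ∂ν := by
      intro k
      rw [← lintegral_indicator hs']
      refine lintegral_congr fun x => ?_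
      by_cases hx : x ∈ s <;> simp [hx]
    rw [hind, hind] at hkey
    simp only [normalizedSize, integral_div, setIntegral_eval, hkey, ENNReal.toReal_mul]
    rw [pow_succ]
    field_simp

/-- The renormalized generation sizes converge almost surely, as a nonnegative martingale. -/
theorem IsBranchingLaw.exists_limit (h : IsBranchingLaw p ν) (hm0 : offspringMean p ≠ 0)
    (hm : offspringMean p < ∞) :
    ∃ W : (ℕ → ℕ) → ℝ, Measurable W ∧
      ∀ᵐ x ∂ν, Tendsto (fun n => normalizedSize (offspringMean p).toReal n x) atTop
        (𝓝 (W x)) := by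
  have hpos := ENNReal.toReal_pos hm0 hm.ne
  refine measurable_limit_of_tendsto_metrizable_ae
    (fun n => (measurable_normalizedSize _ n).aemeasurable)
    ((h.martingale hm0 hm).submartingale.exists_ae_tendsto_of_bdd (R := 1) fun n => ?_)
  rw [eLpNorm_one_eq_lintegral_enorm]
  have : ∀ x : ℕ → ℕ, ‖normalizedSize (offspringMean p).toReal n x‖ₑ =
      (x n : ℝ≥0∞) * (offspringMean p ^ n)⁻¹ := by
    intro x
    rw [normalizedSize, Real.enorm_of_nonneg (by positivity),
      ENNReal.ofReal_div_of_pos (by positivity), ENNReal.ofReal_natCast,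
      ENNReal.ofReal_pow hpos.le, ENNReal.ofReal_toReal hm.ne, div_eq_mul_inv]
  simp_rw [this]
  rw [lintegral_mul_const _ (measurable_eval_ennreal n), h.lintegral_eval,
    ENNReal.mul_inv_cancel (pow_ne_zero n hm0) (ENNReal.pow_ne_top hm.ne)]
  simp

end BranchingLaw

/-! ### Expansion of the generating function at `1` -/

/-- The remainder `∑ j < n, (1 - (1 - x) ^ j)` in the expansion
`1 - (1 - x) ^ n = x * (n - powDefect n x)`. -/
noncomputable def powDefect (n : ℕ) (x : ℝ) : ℝ := ∑ j ∈ Finset.range n, (1 - (1 - x) ^ j)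

theorem one_sub_pow_eq (n : ℕ) (x : ℝ) : 1 - (1 - x) ^ n = x * (n - powDefect n x) := by
  have h := mul_neg_geom_sum (1 - x) n
  simp only [sub_sub_cancel] at h
  rw [← h]
  simp [powDefect]

section PowDefect

variable {x : ℝ} (hx : x ∈ Set.Icc (0 : ℝ) 1)

include hx

theorem powDefect_nonneg (n : ℕ) : 0 ≤ powDefect n x :=
  Finset.sum_nonneg fun _ _ =>
    sub_nonneg.2 (pow_le_one₀ (sub_nonneg.2 hx.2) (sub_le_self 1 hx.1))

theorem powDefect_le (n : ℕ) : powDefect n x ≤ n := by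
  have h : ∀ j ∈ Finset.range n, 1 - (1 - x) ^ j ≤ 1 := fun _ _ =>
    sub_le_self _ (pow_nonneg (sub_nonneg.2 hx.2) _)
  simpa [powDefect] using Finset.sum_le_sum h

theorem powDefect_le_mul (n : ℕ) : powDefect n x ≤ n * (n * x) := by
  have h : ∀ j ∈ Finset.range n, 1 - (1 - x) ^ j ≤ n * x := by
    intro j hj
    have h1 := one_add_mul_le_pow (a := -x) (by linarith [hx.2]) j
    have h2 : (j : ℝ) * x ≤ n * x :=
      mul_le_mul_of_nonneg_right (by exact_mod_cast (Finset.mem_range.1 hj).le) hx.1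
    rw [← sub_eq_add_neg] at h1
    linarith
  simpa [powDefect] using Finset.sum_le_sum h

theorem half_le_powDefect {n : ℕ} (hn : 2 ≤ n * x) : (n : ℝ) / 2 ≤ powDefect n x := by
  have hx0 : 0 < x := by
    rcases hx.1.eq_or_lt with h | h
    · rw [← h] at hn; norm_num at hn
    · exact h
  have h := one_sub_pow_eq n x
  have h1 : (0 : ℝ) ≤ (1 - x) ^ n := pow_nonneg (sub_nonneg.2 hx.2) n
  have h2 : x * (n - powDefect n x) ≤ x * (n / 2) := by nlinarith
  linarith [le_of_mul_le_mul_left h2 hx0]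

end PowDefect

theorem powDefect_mono (n : ℕ) : MonotoneOn (powDefect n) (Set.Icc 0 1) := fun _ _ _ hy hxy =>
  Finset.sum_le_sum fun _ _ => sub_le_sub_left
    (pow_le_pow_left₀ (sub_nonneg.2 hy.2) (sub_le_sub_left hxy 1) _) 1

theorem powDefect_lt {n : ℕ} (hn : 2 ≤ n) {x y : ℝ} (hy : y ∈ Set.Icc (0 : ℝ) 1) (hxy : x < y) :
    powDefect n x < powDefect n y := by
  refine Finset.sum_lt_sum (fun _ _ => sub_le_sub_left
    (pow_le_pow_left₀ (sub_nonneg.2 hy.2) (sub_le_sub_left hxy.le 1) _) 1)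
    ⟨1, Finset.mem_range.2 (by omega), ?_⟩
  simpa using hxy

/-- The remainder `B` in the expansion `1 - g (1 - x) = x * (m - B x)` of the generating function
at `1`. The integrability of `ζ log⁺ ζ` amounts to the summability of `B` along geometric
sequences. -/
noncomputable def genDefect (p : PMF ℕ) (x : ℝ) : ℝ := ∑' n, (p n).toReal * powDefect n x

section GenDefect

variable {p : PMF ℕ}

theorem summable_mean (hm : offspringMean p < ∞) : Summable fun n : ℕ => (p n).toReal * n := by
  simpa using ENNReal.summable_toReal hm.ne

theorem tsum_mean : ∑' n : ℕ, (p n).toReal * n = (offspringMean p).toReal := by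
  rw [offspringMean, ENNReal.tsum_toReal_eq
    fun n => ENNReal.mul_ne_top (p.apply_ne_top n) (ENNReal.natCast_ne_top n)]
  simp

theorem genDefect_nonneg {x : ℝ} (hx : x ∈ Set.Icc (0 : ℝ) 1) : 0 ≤ genDefect p x :=
  tsum_nonneg fun n => mul_nonneg ENNReal.toReal_nonneg (powDefect_nonneg hx n)

variable (hm : offspringMean p < ∞)

include hm

theorem summable_genDefect {x : ℝ} (hx : x ∈ Set.Icc (0 : ℝ) 1) :
    Summable fun n => (p n).toReal * powDefect n x :=
  Summable.of_nonneg_of_le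
    (fun n => mul_nonneg ENNReal.toReal_nonneg (powDefect_nonneg hx n))
    (fun n => mul_le_mul_of_nonneg_left (powDefect_le hx n) ENNReal.toReal_nonneg)
    (summable_mean hm)

theorem genDefect_le {x : ℝ} (hx : x ∈ Set.Icc (0 : ℝ) 1) :
    genDefect p x ≤ (offspringMean p).toReal :=
  ((summable_genDefect hm hx).tsum_le_tsum
    (fun n => mul_le_mul_of_nonneg_left (powDefect_le hx n) ENNReal.toReal_nonneg)
    (summable_mean hm)).trans_eq tsum_mean

theorem genDefect_mono : MonotoneOn (genDefect p) (Set.Icc 0 1) := fun _ hx _ hy hxy =>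
  (summable_genDefect hm hx).tsum_le_tsum
    (fun n => mul_le_mul_of_nonneg_left (powDefect_mono n hx hy hxy) ENNReal.toReal_nonneg)
    (summable_genDefect hm hy)

/-- A mean larger than `1` forces an atom at some `n ≥ 2`, hence strict convexity of `g`, in the
form of strict monotonicity of `B`. -/
theorem genDefect_strictMono (hm1 : 1 < offspringMean p) :
    StrictMonoOn (genDefect p) (Set.Icc 0 1) := by
  intro x hx y hy hxy
  obtain ⟨n, hn, hpn⟩ : ∃ n : ℕ, 2 ≤ n ∧ p n ≠ 0 := by
    by_contra! h
    refine hm1.not_ge ?_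
    rw [← p.tsum_coe, offspringMean]
    refine ENNReal.tsum_le_tsum fun n => ?_
    rcases lt_or_ge n 2 with hn | hn
    · interval_cases n <;> simp
    · simp [h n hn]
  refine (summable_genDefect hm hx).tsum_lt_tsum (i := n)
    (fun n => mul_le_mul_of_nonneg_left (powDefect_mono n hx hy hxy.le) ENNReal.toReal_nonneg)
    (mul_lt_mul_of_pos_left (powDefect_lt hn hy hxy)
      (ENNReal.toReal_pos hpn (p.apply_ne_top n)))
    (summable_genDefect hm hy)

theorem one_sub_offspringGenFun {x : ℝ} (hx : x ∈ Set.Icc (0 : ℝ) 1) :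
    1 - offspringGenFun p (1 - x) = x * ((offspringMean p).toReal - genDefect p x) := by
  have hx' : 1 - x ∈ Set.Icc (0 : ℝ) 1 := ⟨sub_nonneg.2 hx.2, sub_le_self 1 hx.1⟩
  nth_rewrite 1 [← tsum_pmf p]
  rw [offspringGenFun, ← (summable_pmf p).tsum_sub (summable_offspringGenFun p hx'),
    ← tsum_mean, genDefect, ← (summable_mean hm).tsum_sub (summable_genDefect hm hx),
    ← tsum_mul_left]
  refine tsum_congr fun n => ?_
  linear_combination (p n).toReal * one_sub_pow_eq n x

theorem ofReal_genDefect {x : ℝ} (hx : x ∈ Set.Icc (0 : ℝ) 1) :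
    ENNReal.ofReal (genDefect p x) = ∑' n, p n * ENNReal.ofReal (powDefect n x) := by
  rw [genDefect, ENNReal.ofReal_tsum_of_nonneg
    (fun n => mul_nonneg ENNReal.toReal_nonneg (powDefect_nonneg hx n)) (summable_genDefect hm hx)]
  refine tsum_congr fun n => ?_
  rw [ENNReal.ofReal_mul ENNReal.toReal_nonneg, ENNReal.ofReal_toReal (p.apply_ne_top n)]

/-- A root of `g r = r` with `r < 1` is unique. -/
theorem root_unique (hm1 : 1 < offspringMean p) {r s : ℝ} (hr : r ∈ Set.Icc (0 : ℝ) 1)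
    (hs : s ∈ Set.Icc (0 : ℝ) 1) (hr1 : r < 1) (hs1 : s < 1) (hgr : offspringGenFun p r = r)
    (hgs : offspringGenFun p s = s) : r = s := by
  have key : ∀ t ∈ Set.Icc (0 : ℝ) 1, t < 1 → offspringGenFun p t = t →
      1 - t ∈ Set.Icc (0 : ℝ) 1 ∧ genDefect p (1 - t) = (offspringMean p).toReal - 1 := by
    intro t ht ht1 hgt
    have ht' : 1 - t ∈ Set.Icc (0 : ℝ) 1 := ⟨sub_nonneg.2 ht.2, sub_le_self 1 ht.1⟩
    have h := one_sub_offspringGenFun hm ht'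
    rw [sub_sub_cancel, hgt] at h
    have hpos : 0 < 1 - t := sub_pos.2 ht1
    refine ⟨ht', ?_⟩
    have := mul_left_cancel₀ hpos.ne' ((mul_one _).trans h)
    linarith
  obtain ⟨hr', hBr⟩ := key r hr hr1 hgr
  obtain ⟨hs', hBs⟩ := key s hs hs1 hgs
  have := (genDefect_strictMono hm hm1).injOn hr' hs' (hBr.trans hBs.symm)
  linarith

end GenDefect

/-! ### Fixed points of the generating function -/

/-- The smallest fixed point of the generating function is the limit of the iterates at `0`. -/
theorem exists_isLeast_root (p : PMF ℕ) :
    ∃ q : ℝ, IsLeast {r : ℝ | r ∈ Set.Icc 0 1 ∧ offspringGenFun p r = r} q ∧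
      Tendsto (fun n => (offspringGenFun p)^[n] 0) atTop (𝓝 q) := by
  have h0 : (0 : ℝ) ∈ Set.Icc (0 : ℝ) 1 := ⟨le_rfl, zero_le_one⟩
  have hmem := fun n => iterate_offspringGenFun_mem p n h0
  have hmono : Monotone fun n => (offspringGenFun p)^[n] 0 := by
    refine monotone_nat_of_le_succ fun n => ?_
    induction n with
    | zero => exact (hmem 1).1
    | succ n ih =>
      simp only [Function.iterate_succ_apply'] at ih ⊢
      exact offspringGenFun_monotoneOn p (hmem n)
        (by simpa only [Function.iterate_succ_apply'] using hmem (n + 1)) ih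
  obtain ⟨q, hq⟩ : ∃ q, Tendsto (fun n => (offspringGenFun p)^[n] 0) atTop (𝓝 q) :=
    ⟨_, tendsto_atTop_ciSup hmono ⟨1, by rintro _ ⟨n, rfl⟩; exact (hmem n).2⟩⟩
  have hqm : q ∈ Set.Icc (0 : ℝ) 1 := isClosed_Icc.mem_of_tendsto hq (Eventually.of_forall hmem)
  refine ⟨q, ⟨⟨hqm, ?_⟩, fun r hr => ?_⟩, hq⟩
  · have h1 : Tendsto (fun n => offspringGenFun p ((offspringGenFun p)^[n] 0)) atTop
        (𝓝 (offspringGenFun p q)) :=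
      (offspringGenFun_continuousOn p q hqm).tendsto.comp
        (tendsto_nhdsWithin_iff.2 ⟨hq, Eventually.of_forall hmem⟩)
    have h2 := hq.comp (tendsto_add_atTop_nat 1)
    refine tendsto_nhds_unique h1 (h2.congr fun n => ?_)
    simp only [Function.comp_apply, Function.iterate_succ_apply']
  · refine le_of_tendsto' hq fun n => ?_
    induction n with
    | zero => exact hr.1.1
    | succ n ih =>
      rw [Function.iterate_succ_apply', ← hr.2]
      exact offspringGenFun_monotoneOn p (hmem n) hr.1 ih

/-! ### The `L log L` condition and sums along geometric sequences -/

theorem mul_inv_pow_mem {M c : ℝ} (hM : 1 < M) (hc0 : 0 ≤ c) (hc1 : c ≤ 1) (k : ℕ) :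
    c * M⁻¹ ^ k ∈ Set.Icc (0 : ℝ) 1 := by
  have hM' : 0 ≤ M⁻¹ := inv_nonneg.2 (zero_le_one.trans hM.le)
  exact ⟨by positivity, mul_le_one₀ hc1 (by positivity)
    (pow_le_one₀ hM' (inv_le_one_of_one_le₀ hM.le))⟩

theorem inv_pow_mem {M : ℝ} (hM : 1 < M) (k : ℕ) : M⁻¹ ^ k ∈ Set.Icc (0 : ℝ) 1 := by
  simpa using mul_inv_pow_mem hM zero_le_one le_rfl k

/-- Up to about `log n / log M`, the terms are at most `n`; after that, they decay
geometrically. -/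
theorem tsum_powDefect_le {M : ℝ} (hM : 1 < M) (n : ℕ) :
    ∑' k : ℕ, ENNReal.ofReal (powDefect n (M⁻¹ ^ k)) ≤
      ENNReal.ofReal (Real.log M)⁻¹ * ENNReal.ofReal (n * max (Real.log n) 0) +
        ENNReal.ofReal (1 + (1 - M⁻¹)⁻¹) * n := by
  have hM0 : 0 < M := zero_lt_one.trans hM
  have hinv : M⁻¹ < 1 := inv_lt_one_of_one_lt₀ hM
  have hlM : 0 < Real.log M := Real.log_pos hM
  have hmem : ∀ k, M⁻¹ ^ k ∈ Set.Icc (0 : ℝ) 1 := inv_pow_mem hM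
  rcases Nat.eq_zero_or_pos n with rfl | hn
  · simp [powDefect]
  have hn0 : (0 : ℝ) < n := by exact_mod_cast hn
  obtain ⟨L, hLdef⟩ : ∃ L, L = max (Real.log n) 0 := ⟨_, rfl⟩
  rw [← hLdef]
  have hL : 0 ≤ L := hLdef ▸ le_max_right _ _
  obtain ⟨K, hK⟩ : ∃ K, K = ⌈L / Real.log M⌉₊ := ⟨_, rfl⟩
  have hK1 : (K : ℝ) ≤ L / Real.log M + 1 :=
    hK ▸ (Nat.ceil_lt_add_one (div_nonneg hL hlM.le)).le
  have hK2 : (n : ℝ) * M⁻¹ ^ K ≤ 1 := by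
    have h1 : Real.log n ≤ K * Real.log M := by
      have := (div_le_iff₀ hlM).1 (Nat.le_ceil (L / Real.log M))
      rw [← hK] at this
      exact (hLdef ▸ le_max_left _ _ : Real.log n ≤ L).trans this
    rw [← Real.log_pow, Real.log_le_log_iff hn0 (by positivity)] at h1
    rw [inv_pow, ← div_eq_mul_inv]
    exact div_le_one_of_le₀ h1 (by positivity)
  have hsplit : ∑ k ∈ Finset.range K, ENNReal.ofReal (powDefect n (M⁻¹ ^ k)) +
      ∑' k, ENNReal.ofReal (powDefect n (M⁻¹ ^ (k + K))) =
      ∑' k, ENNReal.ofReal (powDefect n (M⁻¹ ^ k)) :=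
    ENNReal.summable.sum_add_tsum_nat_add' (f := fun k => ENNReal.ofReal (powDefect n (M⁻¹ ^ k)))
  rw [← hsplit]
  have h1 : ∑ k ∈ Finset.range K, ENNReal.ofReal (powDefect n (M⁻¹ ^ k)) ≤
      ENNReal.ofReal (K * n) := by
    rw [← ENNReal.ofReal_sum_of_nonneg fun k _ => powDefect_nonneg (hmem k) n]
    refine ENNReal.ofReal_le_ofReal ?_
    have h := Finset.sum_le_sum fun k (_ : k ∈ Finset.range K) => powDefect_le (hmem k) n
    simpa only [Finset.sum_const, Finset.card_range, nsmul_eq_mul] using h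
  have h2 : ∑' k, ENNReal.ofReal (powDefect n (M⁻¹ ^ (k + K))) ≤
      ENNReal.ofReal (n * (1 - M⁻¹)⁻¹) := by
    rw [← tsum_geometric_of_lt_one (by positivity) hinv, ← tsum_mul_left,
      ENNReal.ofReal_tsum_of_nonneg (fun k => by positivity)
        ((summable_geometric_of_lt_one (by positivity) hinv).mul_left _)]
    refine ENNReal.tsum_le_tsum fun k => ENNReal.ofReal_le_ofReal
      ((powDefect_le_mul (hmem _) n).trans (mul_le_mul_of_nonneg_left ?_ hn0.le))
    rw [pow_add]
    nlinarith [pow_nonneg (inv_nonneg.2 hM0.le) k]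
  refine (add_le_add h1 h2).trans ?_
  have h3 : 0 ≤ (1 - M⁻¹)⁻¹ := inv_nonneg.2 (sub_nonneg.2 hinv.le)
  rw [← ENNReal.ofReal_add (by positivity) (by positivity), ← ENNReal.ofReal_natCast n,
    ← ENNReal.ofReal_mul (by positivity), ← ENNReal.ofReal_mul (by positivity),
    ← ENNReal.ofReal_add (by positivity) (by positivity)]
  refine ENNReal.ofReal_le_ofReal ?_
  have h4 := mul_le_mul_of_nonneg_right hK1 hn0.le
  rw [div_eq_mul_inv] at h4
  linarith

/-- About `log n / log M` terms are at least `n / 2`. -/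
theorem ofReal_mul_log_le {M c : ℝ} (hM : 1 < M) (hc0 : 0 < c) (hc1 : c ≤ 1) (n : ℕ) :
    ENNReal.ofReal (n * max (Real.log n) 0) ≤
      ENNReal.ofReal (2 * Real.log M) * ∑' k : ℕ, ENNReal.ofReal (powDefect n (c * M⁻¹ ^ k)) +
        ENNReal.ofReal (Real.log (2 / c)) * n := by
  have hM0 : 0 < M := zero_lt_one.trans hM
  have hlM : 0 < Real.log M := Real.log_pos hM
  rcases Nat.eq_zero_or_pos n with rfl | hn
  · simp
  have hn0 : (0 : ℝ) < n := by exact_mod_cast hn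
  have hlc : 0 ≤ Real.log (2 / c) := Real.log_nonneg ((one_le_div hc0).2 (by linarith))
  have hln : 0 ≤ Real.log n := Real.log_natCast_nonneg n
  have hsplit : Real.log n = Real.log (n * c / 2) + Real.log (2 / c) := by
    rw [← Real.log_mul (by positivity) (by positivity)]
    congr 1
    field_simp
  rw [max_eq_left hln, ← ENNReal.ofReal_natCast n, ← ENNReal.ofReal_mul hlc]
  rcases le_total (Real.log (n * c / 2)) 0 with hneg | hpos
  · refine le_add_left (ENNReal.ofReal_le_ofReal ?_)
    nlinarith
  set L := Real.log (n * c / 2)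
  set N := ⌊L / Real.log M⌋₊ + 1 with hN
  have hterm : ∀ k ∈ Finset.range N,
      ENNReal.ofReal (n / 2) ≤ ENNReal.ofReal (powDefect n (c * M⁻¹ ^ k)) := by
    intro k hk
    refine ENNReal.ofReal_le_ofReal
      (half_le_powDefect (mul_inv_pow_mem hM hc0.le hc1 k) ?_)
    have hk' : k ≤ ⌊L / Real.log M⌋₊ := Nat.lt_succ_iff.1 (Finset.mem_range.1 hk)
    have h1 : (k : ℝ) * Real.log M ≤ L :=
      (le_div_iff₀ hlM).1 ((Nat.le_floor_iff (by positivity)).1 hk')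
    rw [← Real.log_pow, Real.log_le_log_iff (by positivity) (by positivity)] at h1
    rw [inv_pow, ← mul_assoc, ← div_eq_mul_inv, le_div_iff₀ (by positivity)]
    linarith
  have hsum : ENNReal.ofReal (L / Real.log M * (n / 2)) ≤
      ∑' k : ℕ, ENNReal.ofReal (powDefect n (c * M⁻¹ ^ k)) := by
    refine le_trans ?_ (ENNReal.sum_le_tsum (Finset.range N))
    refine le_trans ?_ (Finset.card_nsmul_le_sum _ _ _ hterm)
    rw [Finset.card_range, nsmul_eq_mul, ← ENNReal.ofReal_natCast N,
      ← ENNReal.ofReal_mul (Nat.cast_nonneg N)]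
    refine ENNReal.ofReal_le_ofReal (mul_le_mul_of_nonneg_right ?_ (by positivity))
    rw [hN]
    push_cast
    exact (Nat.lt_floor_add_one _).le
  refine le_trans ?_ (add_le_add_left (mul_le_mul_right hsum _) _)
  rw [← ENNReal.ofReal_mul (by positivity),
    ← ENNReal.ofReal_add (by positivity) (by positivity)]
  refine ENNReal.ofReal_le_ofReal (le_of_eq ?_)
  rw [hsplit]
  field_simp

section KestenStigum

variable {p : PMF ℕ} {M : ℝ}

theorem tsum_genDefect (hm : offspringMean p < ∞) {x : ℕ → ℝ}
    (hx : ∀ k, x k ∈ Set.Icc (0 : ℝ) 1) :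
    ∑' k, ENNReal.ofReal (genDefect p (x k)) =
      ∑' n, p n * ∑' k, ENNReal.ofReal (powDefect n (x k)) := by
  simp_rw [fun k => ofReal_genDefect hm (hx k)]
  rw [ENNReal.tsum_comm]
  simp_rw [ENNReal.tsum_mul_left]

/-- If `E[ζ log⁺ ζ]` is finite, the remainder `B` is summable along geometric sequences. -/
theorem tsum_genDefect_lt_top (hm : offspringMean p < ∞) (hM : 1 < M)
    (hL : offspringLogMoment p < ∞) :
    ∑' k : ℕ, ENNReal.ofReal (genDefect p (M⁻¹ ^ k)) < ∞ := by
  rw [tsum_genDefect hm (inv_pow_mem hM)]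
  calc ∑' n, p n * ∑' k, ENNReal.ofReal (powDefect n (M⁻¹ ^ k))
      ≤ ∑' n : ℕ, (ENNReal.ofReal (Real.log M)⁻¹ *
          (p n * ENNReal.ofReal (n * max (Real.log n) 0)) +
          ENNReal.ofReal (1 + (1 - M⁻¹)⁻¹) * (p n * n)) := by
        refine ENNReal.tsum_le_tsum fun n => ?_
        refine (mul_le_mul_right (tsum_powDefect_le hM n) _).trans_eq ?_
        ring
    _ = ENNReal.ofReal (Real.log M)⁻¹ * offspringLogMoment p +
          ENNReal.ofReal (1 + (1 - M⁻¹)⁻¹) * offspringMean p := by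
        rw [ENNReal.tsum_add, ENNReal.tsum_mul_left, ENNReal.tsum_mul_left,
          offspringLogMoment, offspringMean]
    _ < ∞ := ENNReal.add_lt_top.2
        ⟨ENNReal.mul_lt_top ENNReal.ofReal_lt_top hL, ENNReal.mul_lt_top ENNReal.ofReal_lt_top hm⟩

/-- Summability of `B` along a single sequence `c * M ^ (-k)` gives the converse of
`tsum_genDefect_lt_top`. -/
theorem offspringLogMoment_lt_top (hm : offspringMean p < ∞) (hM : 1 < M) {c : ℝ} (hc0 : 0 < c)
    (hc1 : c ≤ 1) (hS : ∑' k : ℕ, ENNReal.ofReal (genDefect p (c * M⁻¹ ^ k)) < ∞) :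
    offspringLogMoment p < ∞ := by
  rw [tsum_genDefect hm (mul_inv_pow_mem hM hc0.le hc1)] at hS
  calc offspringLogMoment p
      ≤ ∑' n : ℕ, (ENNReal.ofReal (2 * Real.log M) *
          (p n * ∑' k : ℕ, ENNReal.ofReal (powDefect n (c * M⁻¹ ^ k))) +
          ENNReal.ofReal (Real.log (2 / c)) * (p n * n)) := by
        refine ENNReal.tsum_le_tsum fun n => ?_
        refine (mul_le_mul_right (ofReal_mul_log_le hM hc0 hc1 n) _).trans_eq ?_
        ring
    _ = ENNReal.ofReal (2 * Real.log M) *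
          (∑' n, p n * ∑' k : ℕ, ENNReal.ofReal (powDefect n (c * M⁻¹ ^ k))) +
          ENNReal.ofReal (Real.log (2 / c)) * offspringMean p := by
        rw [ENNReal.tsum_add, ENNReal.tsum_mul_left, ENNReal.tsum_mul_left, offspringMean]
    _ < ∞ := ENNReal.add_lt_top.2
        ⟨ENNReal.mul_lt_top ENNReal.ofReal_lt_top hS, ENNReal.mul_lt_top ENNReal.ofReal_lt_top hm⟩

/-! ### Laplace transforms of the renormalized generation sizes -/

/-- `1 - E[exp (-l * W_n)]`, where `W_n` is the size of generation `n` divided by `m ^ n`. -/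
noncomputable def laplaceDefect (p : PMF ℕ) (n : ℕ) (l : ℝ) : ℝ :=
  1 - (offspringGenFun p)^[n] (Real.exp (-(l / (offspringMean p).toReal ^ n)))

theorem exp_neg_mem {l : ℝ} (hl : 0 ≤ l) : Real.exp (-l) ∈ Set.Icc (0 : ℝ) 1 :=
  ⟨(Real.exp_pos _).le, Real.exp_le_one_iff.2 (neg_nonpos.2 hl)⟩

theorem laplaceDefect_mem (n : ℕ) {l : ℝ} (hl : 0 ≤ l) :
    laplaceDefect p n l ∈ Set.Icc (0 : ℝ) 1 := by
  have h := iterate_offspringGenFun_mem p n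
    (exp_neg_mem (div_nonneg hl (pow_nonneg (ENNReal.toReal_nonneg (a := offspringMean p)) n)))
  exact ⟨sub_nonneg.2 h.2, sub_le_self 1 h.1⟩

/-- The recursion `g^[n + 1] = g ∘ g^[n]`, written with the expansion of `g` at `1`. -/
theorem laplaceDefect_succ (hm : offspringMean p < ∞) (n : ℕ) {l : ℝ} (hl : 0 ≤ l) :
    laplaceDefect p (n + 1) l = laplaceDefect p n (l / (offspringMean p).toReal) *
      ((offspringMean p).toReal -
        genDefect p (laplaceDefect p n (l / (offspringMean p).toReal))) := by
  rw [← one_sub_offspringGenFun hm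
    (laplaceDefect_mem n (div_nonneg hl ENNReal.toReal_nonneg))]
  simp only [laplaceDefect, sub_sub_cancel, Function.iterate_succ_apply', pow_succ', div_div]

theorem laplaceDefect_le (hm1 : 1 < (offspringMean p).toReal) (hm : offspringMean p < ∞)
    (n : ℕ) {l : ℝ} (hl : 0 ≤ l) : laplaceDefect p n l ≤ l := by
  have hm0 := zero_lt_one.trans hm1
  induction n generalizing l with
  | zero =>
    have := Real.add_one_le_exp (-l)
    simp only [laplaceDefect, Function.iterate_zero, id, pow_zero, div_one]
    linarith
  | succ n ih =>
    have hl' : 0 ≤ l / (offspringMean p).toReal := div_nonneg hl hm0.le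
    have hmem := laplaceDefect_mem (p := p) n hl'
    rw [laplaceDefect_succ hm n hl]
    calc _ ≤ l / (offspringMean p).toReal * (offspringMean p).toReal :=
          mul_le_mul (ih hl') (sub_le_self _ (genDefect_nonneg hmem))
            (sub_nonneg.2 (genDefect_le hm hmem)) hl'
      _ = l := div_mul_cancel₀ _ hm0.ne'

/-- Iterating `laplaceDefect_succ` and bounding the argument of `B` by `laplaceDefect_le` gives a
lower bound by the product of the factors `1 - B (m ^ (-k)) / m`, hence by `1` minus the sum of
the `B (m ^ (-k)) / m`. -/
theorem le_laplaceDefect (hm1 : 1 < (offspringMean p).toReal) (hm : offspringMean p < ∞)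
    (n K : ℕ) :
    (offspringMean p).toReal⁻¹ ^ K / 2 * (1 - ∑ k ∈ Finset.range n,
      genDefect p ((offspringMean p).toReal⁻¹ ^ (k + (K + 1))) / (offspringMean p).toReal) ≤
      laplaceDefect p n ((offspringMean p).toReal⁻¹ ^ K) := by
  set m := (offspringMean p).toReal
  have hm0 := zero_lt_one.trans hm1
  have hpow : ∀ k : ℕ, m⁻¹ ^ k ∈ Set.Icc (0 : ℝ) 1 := inv_pow_mem hm1
  induction n generalizing K with
  | zero =>
    have hx := hpow K
    -- `exp (-x) ≤ 1 - x / 2` on `[0, 1]`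
    have h1 : (1 - m⁻¹ ^ K / 2) * Real.exp (m⁻¹ ^ K) ≥ 1 := by
      have := Real.add_one_le_exp (m⁻¹ ^ K)
      nlinarith [hx.1, hx.2]
    have h2 : Real.exp (-m⁻¹ ^ K) ≤ 1 - m⁻¹ ^ K / 2 := by
      rw [Real.exp_neg, inv_le_iff_one_le_mul₀ (Real.exp_pos _)]
      exact h1
    simp only [laplaceDefect, Finset.range_zero, Finset.sum_empty, Function.iterate_zero, id,
      pow_zero, div_one]
    linarith
  | succ n ih =>
    have hdiv : m⁻¹ ^ K / m = m⁻¹ ^ (K + 1) := by rw [pow_succ, div_eq_mul_inv]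
    rw [laplaceDefect_succ hm n (hpow K).1, hdiv]
    set y := laplaceDefect p n (m⁻¹ ^ (K + 1)) with hy
    set x := m⁻¹ ^ (K + 1) with hx
    have hxK : x * m = m⁻¹ ^ K := by rw [← hdiv, div_mul_cancel₀ _ hm0.ne']
    have hymem : y ∈ Set.Icc (0 : ℝ) 1 := laplaceDefect_mem n (hpow (K + 1)).1
    have hBy : genDefect p y ≤ genDefect p x := genDefect_mono hm hymem (hpow (K + 1))
      (laplaceDefect_le hm1 hm n (hpow (K + 1)).1)
    have hBx := genDefect_le hm (hpow (K + 1))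
    have hBx0 := genDefect_nonneg (p := p) (hpow (K + 1))
    have hS : 0 ≤ ∑ k ∈ Finset.range n, genDefect p (m⁻¹ ^ (k + (K + 1 + 1))) / m :=
      Finset.sum_nonneg fun k _ => div_nonneg (genDefect_nonneg (hpow _)) hm0.le
    have hih := ih (K + 1)
    rw [Finset.sum_range_succ', zero_add, ← hx]
    simp only [fun k : ℕ => show k + 1 + (K + 1) = k + (K + 1 + 1) by omega]
    set S := ∑ k ∈ Finset.range n, genDefect p (m⁻¹ ^ (k + (K + 1 + 1))) / m
    set B := genDefect p x
    have hx0 : 0 ≤ x := (hpow (K + 1)).1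
    calc m⁻¹ ^ K / 2 * (1 - (S + B / m)) = x / 2 * ((1 - S) * (m - B) - S * B) := by
          rw [← hxK]
          field_simp
          ring
      _ ≤ x / 2 * (1 - S) * (m - B) := by
          have := mul_nonneg (mul_nonneg hx0 hS) hBx0
          linarith
      _ ≤ y * (m - B) := mul_le_mul_of_nonneg_right hih (sub_nonneg.2 hBx)
      _ ≤ y * (m - genDefect p y) := mul_le_mul_of_nonneg_left (sub_le_sub_left hBy _) hymem.1

/-- If `E[ζ log⁺ ζ]` is finite, the Laplace transforms of the `W_n` stay away from `1`. -/
theorem exists_le_laplaceDefect (hm1 : 1 < (offspringMean p).toReal) (hm : offspringMean p < ∞)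
    (hL : offspringLogMoment p < ∞) :
    ∃ l > 0, ∃ ε > 0, ∀ n, ε ≤ laplaceDefect p n l := by
  set m := (offspringMean p).toReal
  have hm0 := zero_lt_one.trans hm1
  have hsum : Summable fun k : ℕ => genDefect p (m⁻¹ ^ k) / m := by
    refine Summable.div_const ?_ m
    refine (ENNReal.summable_toReal (tsum_genDefect_lt_top hm hm1 hL).ne).congr fun k => ?_
    exact ENNReal.toReal_ofReal (genDefect_nonneg (inv_pow_mem hm1 k))
  obtain ⟨K, hK⟩ := (((tendsto_sum_nat_add fun k : ℕ => genDefect p (m⁻¹ ^ k) / m).comp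
    (tendsto_add_atTop_nat 1)).eventually_lt_const (half_pos one_pos)).exists
  refine ⟨m⁻¹ ^ K, by positivity, m⁻¹ ^ K / 4, by positivity, fun n => ?_⟩
  refine le_trans ?_ (le_laplaceDefect hm1 hm n K)
  have hn : ∑ k ∈ Finset.range n, genDefect p (m⁻¹ ^ (k + (K + 1))) / m ≤ 1 / 2 :=
    (((summable_nat_add_iff (K + 1)).2 hsum).sum_le_tsum _ fun k _ => div_nonneg
      (genDefect_nonneg (inv_pow_mem hm1 _))
      hm0.le).trans hK.le
  have : 0 < m⁻¹ ^ K := by positivity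
  nlinarith

/-- A nonzero solution `y k = 1 - φ (m ^ (-k))` of the functional equation `φ (m * l) = g (φ l)`,
with the bound `1 - φ l ≤ l`, exists only if `E[ζ log⁺ ζ]` is finite. -/
theorem offspringLogMoment_lt_top_of_solution (hm1 : 1 < (offspringMean p).toReal)
    (hm : offspringMean p < ∞) {y : ℕ → ℝ} (hy : ∀ k, y k ∈ Set.Icc (0 : ℝ) 1)
    (hrec : ∀ k, y k = y (k + 1) * ((offspringMean p).toReal - genDefect p (y (k + 1))))
    (hle : ∀ k, y k ≤ (offspringMean p).toReal⁻¹ ^ k) (h0 : 0 < y 0) :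
    offspringLogMoment p < ∞ := by
  set m := (offspringMean p).toReal
  have hm0 := zero_lt_one.trans hm1
  have hlower : ∀ k, y 0 * m⁻¹ ^ k ≤ y k := by
    intro k
    induction k with
    | zero => simp
    | succ k ih =>
      have h1 : y k ≤ y (k + 1) * m := by
        rw [hrec k]
        exact mul_le_mul_of_nonneg_left (sub_le_self _ (genDefect_nonneg (hy _))) (hy _).1
      rw [pow_succ, ← mul_assoc, ← div_eq_mul_inv, div_le_iff₀ hm0]
      exact ih.trans h1
  -- Iterating `hrec` gives `y 0` as the product of `m ^ n * y n` and the factors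
  -- `1 - B (y (k + 1)) / m`; these are bounded by exponentials.
  have hprod : ∀ n, y 0 * m⁻¹ ^ n ≤
      y n * Real.exp (-∑ k ∈ Finset.range n, genDefect p (y (k + 1)) / m) := by
    intro n
    induction n with
    | zero => simp
    | succ n ih =>
      have h1 : y n ≤ y (n + 1) * m * Real.exp (-(genDefect p (y (n + 1)) / m)) := by
        have h2 := Real.one_sub_le_exp_neg (genDefect p (y (n + 1)) / m)
        calc y n = y (n + 1) * m * (1 - genDefect p (y (n + 1)) / m) := by
              rw [hrec n]; field_simp
          _ ≤ _ := mul_le_mul_of_nonneg_left h2 (mul_nonneg (hy _).1 hm0.le)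
      rw [pow_succ, ← mul_assoc, ← div_eq_mul_inv, div_le_iff₀ hm0, Finset.sum_range_succ,
        neg_add, Real.exp_add]
      refine ih.trans ((mul_le_mul_of_nonneg_right h1 (Real.exp_pos _).le).trans_eq ?_)
      ring
  have hbound : ∀ n, ∑ k ∈ Finset.range n, genDefect p (y (k + 1)) / m ≤ -Real.log (y 0) := by
    intro n
    have hpos : 0 < m⁻¹ ^ n := by positivity
    have h1 : y 0 * m⁻¹ ^ n ≤
        Real.exp (-∑ k ∈ Finset.range n, genDefect p (y (k + 1)) / m) * m⁻¹ ^ n := by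
      rw [mul_comm (Real.exp _)]
      exact (hprod n).trans (mul_le_mul_of_nonneg_right (hle n) (Real.exp_pos _).le)
    have h2 := (Real.log_le_iff_le_exp h0).2 (le_of_mul_le_mul_right h1 hpos)
    linarith
  have hsum : Summable fun k : ℕ => genDefect p (y (k + 1)) := by
    have := summable_of_sum_range_le (fun k => div_nonneg (genDefect_nonneg (hy (k + 1))) hm0.le)
      hbound
    exact (this.mul_right m).congr fun k => div_mul_cancel₀ _ hm0.ne'
  have hc1 : y 0 * m⁻¹ ≤ 1 := by simpa using (mul_inv_pow_mem hm1 (hy 0).1 (hy 0).2 1).2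
  refine offspringLogMoment_lt_top hm hm1 (c := y 0 * m⁻¹) (by positivity) hc1 ?_
  have hmem := mul_inv_pow_mem hm1 (c := y 0 * m⁻¹) (by positivity) hc1
  calc ∑' k : ℕ, ENNReal.ofReal (genDefect p (y 0 * m⁻¹ * m⁻¹ ^ k))
      ≤ ∑' k : ℕ, ENNReal.ofReal (genDefect p (y (k + 1))) := by
        refine ENNReal.tsum_le_tsum fun k => ENNReal.ofReal_le_ofReal
          (genDefect_mono hm (hmem k) (hy _) ?_)
        rw [mul_assoc, ← pow_succ']
        exact hlower (k + 1)
    _ < ∞ := by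
        rw [← ENNReal.ofReal_tsum_of_nonneg (fun k => genDefect_nonneg (hy _)) hsum]
        exact ENNReal.ofReal_lt_top

end KestenStigum

/-! ### The limit of the renormalized generation sizes -/

section Limit

variable {p : PMF ℕ} {ν : Measure (ℕ → ℕ)} [IsProbabilityMeasure ν]

theorem IsBranchingLaw.measure_eval_eq_zero (h : IsBranchingLaw p ν) (n : ℕ) :
    ν {x | x n = 0} = ENNReal.ofReal ((offspringGenFun p)^[n] 0) := by
  have hms : MeasurableSet {x : ℕ → ℕ | x n = 0} :=
    (measurable_pi_apply n) (measurableSet_singleton 0)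
  rw [← h.lintegral_pow ⟨le_rfl, zero_le_one⟩ n, ← lintegral_indicator_one hms]
  refine lintegral_congr fun x => ?_
  by_cases hx : x n = 0 <;> simp [hx]

theorem IsBranchingLaw.integral_exp (h : IsBranchingLaw p ν) (n : ℕ) {l : ℝ} (hl : 0 ≤ l) :
    ∫ x, Real.exp (-(l * normalizedSize (offspringMean p).toReal n x)) ∂ν =
      1 - laplaceDefect p n l := by
  have hs := exp_neg_mem
    (div_nonneg hl (pow_nonneg (ENNReal.toReal_nonneg (a := offspringMean p)) n))
  have hmeas : Measurable fun x : ℕ → ℕ =>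
      Real.exp (-(l * normalizedSize (offspringMean p).toReal n x)) :=
    ((measurable_normalizedSize _ n).const_mul l).neg.exp
  rw [integral_eq_lintegral_of_nonneg_ae (ae_of_all _ fun x => (Real.exp_pos _).le)
    hmeas.aestronglyMeasurable, laplaceDefect, sub_sub_cancel,
    ← ENNReal.toReal_ofReal (iterate_offspringGenFun_mem p n hs).1,
    ← h.lintegral_pow hs n]
  congr 1
  refine lintegral_congr fun x => ?_
  rw [← ENNReal.ofReal_pow hs.1, ← Real.exp_nat_mul, normalizedSize]
  congr 2
  ring

variable {W : (ℕ → ℕ) → ℝ}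

theorem limit_nonneg {μ : Measure (ℕ → ℕ)}
    (hlim : ∀ᵐ x ∂μ, Tendsto (fun n => normalizedSize (offspringMean p).toReal n x) atTop
      (𝓝 (W x))) : ∀ᵐ x ∂μ, 0 ≤ W x := by
  filter_upwards [hlim] with x hx
  exact ge_of_tendsto' hx fun n =>
    div_nonneg (Nat.cast_nonneg _) (pow_nonneg ENNReal.toReal_nonneg n)

theorem IsBranchingLaw.tendsto_laplaceDefect (h : IsBranchingLaw p ν)
    (hlim : ∀ᵐ x ∂ν, Tendsto (fun n => normalizedSize (offspringMean p).toReal n x) atTop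
      (𝓝 (W x))) {l : ℝ} (hl : 0 ≤ l) :
    Tendsto (fun n => laplaceDefect p n l) atTop
      (𝓝 (1 - ∫ x, Real.exp (-(l * W x)) ∂ν)) := by
  have hT : Tendsto (fun n => ∫ x, Real.exp
      (-(l * normalizedSize (offspringMean p).toReal n x)) ∂ν) atTop
      (𝓝 (∫ x, Real.exp (-(l * W x)) ∂ν)) := by
    refine tendsto_integral_of_dominated_convergence (fun _ => 1)
      (fun n => ((measurable_normalizedSize _ n).const_mul l).neg.exp.aestronglyMeasurable)
      (integrable_const _) (fun n => ae_of_all _ fun x => ?_) ?_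
    · rw [Real.norm_of_nonneg (Real.exp_pos _).le]
      exact (exp_neg_mem (mul_nonneg hl (div_nonneg (Nat.cast_nonneg _)
        (pow_nonneg ENNReal.toReal_nonneg n)))).2
    · filter_upwards [hlim] with x hx
      exact (Real.continuous_exp.tendsto _).comp (hx.const_mul l).neg
  refine (hT.const_sub 1).congr fun n => ?_
  rw [h.integral_exp n hl, sub_sub_cancel]

/-- The functional equation `φ l = g (φ (l / m))` of the Laplace transform of `W`. -/
theorem IsBranchingLaw.laplace_eq (h : IsBranchingLaw p ν)
    (hlim : ∀ᵐ x ∂ν, Tendsto (fun n => normalizedSize (offspringMean p).toReal n x) atTop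
      (𝓝 (W x))) {l : ℝ} (hl : 0 ≤ l) :
    ∫ x, Real.exp (-(l * W x)) ∂ν = offspringGenFun p
      (∫ x, Real.exp (-(l / (offspringMean p).toReal * W x)) ∂ν) := by
  have hl' : 0 ≤ l / (offspringMean p).toReal := div_nonneg hl ENNReal.toReal_nonneg
  have h1 := (h.tendsto_laplaceDefect hlim hl).const_sub 1
  have h2 := (h.tendsto_laplaceDefect hlim hl').const_sub 1
  simp only [sub_sub_cancel] at h1 h2
  have hmem : ∀ n, 1 - laplaceDefect p n (l / (offspringMean p).toReal) ∈ Set.Icc (0 : ℝ) 1 :=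
    fun n => ⟨sub_nonneg.2 (laplaceDefect_mem n hl').2, sub_le_self 1 (laplaceDefect_mem n hl').1⟩
  have hlimmem := isClosed_Icc.mem_of_tendsto h2 (Eventually.of_forall hmem)
  have h3 := (offspringGenFun_continuousOn p _ hlimmem).tendsto.comp
    (tendsto_nhdsWithin_iff.2 ⟨h2, Eventually.of_forall hmem⟩)
  refine tendsto_nhds_unique (h1.comp (tendsto_add_atTop_nat 1)) (h3.congr fun n => ?_)
  simp only [Function.comp_apply, laplaceDefect, sub_sub_cancel, Function.iterate_succ_apply',
    pow_succ', div_div]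

theorem tendsto_laplace_measure (hW : Measurable W) (h0 : ∀ᵐ x ∂ν, 0 ≤ W x) {M : ℝ}
    (hM : 1 < M) :
    Tendsto (fun k : ℕ => ∫ x, Real.exp (-(M ^ k * W x)) ∂ν) atTop
      (𝓝 (ν.real {x | W x = 0})) := by
  have hms : MeasurableSet {x | W x = 0} := hW (measurableSet_singleton 0)
  rw [← integral_indicator_one hms]
  refine tendsto_integral_of_dominated_convergence (fun _ => 1)
    (fun n => (hW.const_mul _).neg.exp.aestronglyMeasurable)
    (integrable_const _) (fun n => ?_) ?_
  · filter_upwards [h0] with x hx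
    rw [Real.norm_of_nonneg (Real.exp_pos _).le]
    exact (exp_neg_mem (mul_nonneg (pow_nonneg (zero_le_one.trans hM.le) n) hx)).2
  · filter_upwards [h0] with x hx
    rcases hx.eq_or_lt with h | h
    · simp [← h]
    · have : x ∉ {x | W x = 0} := h.ne'
      rw [Set.indicator_of_notMem this]
      exact Real.tendsto_exp_neg_atTop_nhds_zero.comp
        ((tendsto_pow_atTop_atTop_of_one_lt hM).atTop_mul_const h)

/-- The two cases of the Kesten-Stigum dichotomy. The probability of `W = 0` is the limit of the
Laplace transform `φ` along `m ^ k`, so it is a fixed point of `g` by the functional equation of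
`φ`, and it is `1` if and only if `φ` is constant. -/
theorem IsBranchingLaw.measure_limit_eq_zero (h : IsBranchingLaw p ν)
    (hm1 : 1 < offspringMean p) (hm : offspringMean p < ∞) (hW : Measurable W)
    (hlim : ∀ᵐ x ∂ν, Tendsto (fun n => normalizedSize (offspringMean p).toReal n x) atTop
      (𝓝 (W x)))
    {q : ℝ} (hq : IsLeast {r : ℝ | r ∈ Set.Icc 0 1 ∧ offspringGenFun p r = r} q) :
    (offspringLogMoment p < ∞ → ν {x | W x = 0} = ENNReal.ofReal q) ∧
      (offspringLogMoment p = ∞ → ν {x | W x = 0} = 1) := by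
  have hm1' : 1 < (offspringMean p).toReal := by
    simpa using (ENNReal.toReal_lt_toReal ENNReal.one_ne_top hm.ne).2 hm1
  have hm0 := zero_lt_one.trans hm1'
  have h0 := limit_nonneg hlim
  have htend := tendsto_laplace_measure hW h0 hm1'
  set m := (offspringMean p).toReal
  set φ : ℝ → ℝ := fun l => ∫ x, Real.exp (-(l * W x)) ∂ν with hφ
  have hfun : ∀ l, 0 ≤ l → φ l = offspringGenFun p (φ (l / m)) := fun l hl => h.laplace_eq hlim hl
  have hpsi : ∀ l, 0 ≤ l → Tendsto (fun n => laplaceDefect p n l) atTop (𝓝 (1 - φ l)) :=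
    fun l hl => h.tendsto_laplaceDefect hlim hl
  have hpsimem : ∀ l, 0 ≤ l → 1 - φ l ∈ Set.Icc (0 : ℝ) 1 := fun l hl =>
    isClosed_Icc.mem_of_tendsto (hpsi l hl) (Eventually.of_forall fun n => laplaceDefect_mem n hl)
  have hφmem : ∀ l, 0 ≤ l → φ l ∈ Set.Icc (0 : ℝ) 1 := fun l hl =>
    ⟨by linarith [(hpsimem l hl).2], by linarith [(hpsimem l hl).1]⟩
  have hstep : ∀ k : ℕ, φ (m ^ (k + 1)) = offspringGenFun p (φ (m ^ k)) := fun k => by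
    rw [hfun _ (pow_nonneg hm0.le _), pow_succ, mul_div_cancel_right₀ _ hm0.ne']
  set r := ν.real {x | W x = 0}
  have hr : r ∈ Set.Icc (0 : ℝ) 1 := ⟨measureReal_nonneg, measureReal_le_one⟩
  have hgr : offspringGenFun p r = r := by
    have h1 := (offspringGenFun_continuousOn p r hr).tendsto.comp (tendsto_nhdsWithin_iff.2
      ⟨htend, Eventually.of_forall fun k => hφmem _ (pow_nonneg hm0.le k)⟩)
    exact tendsto_nhds_unique (h1.congr fun k => (hstep k).symm)
      (htend.comp (tendsto_add_atTop_nat 1))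
  have hνr : ν {x | W x = 0} = ENNReal.ofReal r := (ofReal_measureReal (measure_ne_top _ _)).symm
  rw [hνr]
  refine ⟨fun hL => ?_, fun hL => ?_⟩
  · obtain ⟨l, hl, ε, hε, hle⟩ := exists_le_laplaceDefect hm1' hm hL
    have hφl : φ l < 1 := by
      have := ge_of_tendsto' (hpsi l hl.le) hle
      linarith
    have hr1 : r < 1 := by
      refine lt_of_le_of_ne hr.2 fun hr1 => hφl.ne ?_
      have hae : ∀ᵐ x ∂ν, W x = 0 := by
        rw [hr1, ENNReal.ofReal_one] at hνr
        exact (prob_compl_eq_zero_iff (hW (measurableSet_singleton 0))).2 hνr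
      rw [hφ]
      simp only
      rw [integral_congr_ae (g := fun _ => (1 : ℝ)) (by
        filter_upwards [hae] with x hx
        simp [hx])]
      simp
    -- `q ≤ r < 1`, and `g` has at most one fixed point below `1`.
    rw [root_unique hm hm1 hr hq.1.1 hr1 ((hq.2 ⟨hr, hgr⟩).trans_lt hr1) hgr hq.1.2]
  · have hφ1 : φ 1 = 1 := by
      by_contra hne
      refine hL.not_lt (offspringLogMoment_lt_top_of_solution hm1' hm
        (y := fun k => 1 - φ (m⁻¹ ^ k)) (fun k => hpsimem _ (by positivity)) (fun k => ?_)
        (fun k => ?_) ?_)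
      · have hk : 0 ≤ m⁻¹ ^ (k + 1) := by positivity
        rw [← one_sub_offspringGenFun hm (hpsimem _ hk), sub_sub_cancel,
          hfun (m⁻¹ ^ k) (by positivity), pow_succ, div_eq_mul_inv]
      · exact le_of_tendsto' (hpsi _ (by positivity))
          fun n => laplaceDefect_le hm1' hm n (by positivity)
      · simp only [pow_zero]
        exact sub_pos.2 (lt_of_le_of_ne (hφmem 1 zero_le_one).2 hne)
    have hall : ∀ k : ℕ, φ (m ^ k) = 1 := by
      intro k
      induction k with
      | zero => simpa using hφ1
      | succ k ih => rw [hstep, ih, offspringGenFun_one]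
    have hr1 : r = 1 :=
      tendsto_nhds_unique htend (tendsto_const_nhds.congr fun k => (hall k).symm)
    rw [hr1, ENNReal.ofReal_one]

end Limit

/-! ### Galton-Watson trees -/

/-- The extinction probability is the limit of the probabilities `g^[n] 0` that generation `n` is
empty. -/
theorem IsGWTree.measure_finite {Ω : Type*} [MeasurableSpace Ω] {P : Measure Ω}
    [IsProbabilityMeasure P] {p : PMF ℕ} {τ : Ω → NeveuTree} (hτ : IsGWTree P p τ) {q : ℝ}
    (hq : Tendsto (fun n => (offspringGenFun p)^[n] 0) atTop (𝓝 q)) :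
    P {ω | (τ ω).carrier.Finite} = ENNReal.ofReal q := by
  have hw : Measurable fun ω => (τ ω).widthSeq :=
    NeveuTree.measurable_widthSeq.comp hτ.measurable
  have : IsProbabilityMeasure (P.map fun ω => (τ ω).widthSeq) :=
    Measure.isProbabilityMeasure_map hw.aemeasurable
  have hset : {ω | (τ ω).carrier.Finite} = ⋃ n, {ω | (τ ω).width n = 0} := by
    ext ω
    simp [NeveuTree.finite_carrier_iff]
  have hmono : Monotone fun n => {ω | (τ ω).width n = 0} :=
    fun _ _ hnk _ hω => NeveuTree.width_eq_zero_of_le hnk hω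
  have h1 := tendsto_measure_iUnion_atTop (μ := P) hmono
  rw [← hset] at h1
  refine tendsto_nhds_unique h1 ((ENNReal.tendsto_ofReal hq).congr fun n => ?_)
  have hms : MeasurableSet {x : ℕ → ℕ | x n = 0} :=
    (measurable_pi_apply n) (measurableSet_singleton 0)
  rw [← hτ.isBranchingLaw.measure_eval_eq_zero n, Measure.map_apply hw hms]
  rfl

theorem mainTheorem3 {Ω : Type*} [MeasurableSpace Ω] (P : Measure Ω) [IsProbabilityMeasure P]
    (p : PMF ℕ) (hp0 : 0 < p 0) (hp0' : p 0 < 1) (hp01 : p 0 + p 1 < 1)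
    (hm : 1 < offspringMean p) (hm' : offspringMean p < ∞)
    (τ : Ω → NeveuTree) (hτ : IsGWTree P p τ) :
    ∃ q : ℝ, IsLeast {r : ℝ | r ∈ Set.Icc 0 1 ∧ offspringGenFun p r = r} q ∧
      P {ω | (τ ω).carrier.Finite} = ENNReal.ofReal q ∧
      ∃ W : Ω → ℝ, Measurable W ∧
        (∀ᵐ ω ∂P, Tendsto (fun n : ℕ => normalizedWidth p n (τ ω)) atTop (𝓝 (W ω))) ∧
        (offspringLogMoment p < ∞ → P {ω | W ω = 0} = ENNReal.ofReal q) ∧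
        (offspringLogMoment p = ∞ → P {ω | W ω = 0} = 1) := by
  obtain ⟨q, hq, hqlim⟩ := exists_isLeast_root p
  have hw : Measurable fun ω => (τ ω).widthSeq :=
    NeveuTree.measurable_widthSeq.comp hτ.measurable
  have : IsProbabilityMeasure (P.map fun ω => (τ ω).widthSeq) :=
    Measure.isProbabilityMeasure_map hw.aemeasurable
  have hν := hτ.isBranchingLaw
  obtain ⟨W, hW, hlim⟩ := hν.exists_limit (zero_lt_one.trans hm).ne' hm'
  have hdich := hν.measure_limit_eq_zero hm hm' hW hlim hq
  have hms : MeasurableSet {x | W x = 0} := hW (measurableSet_singleton 0)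
  rw [Measure.map_apply hw hms] at hdich
  exact ⟨q, hq, hτ.measure_finite hqlim, fun ω => W (τ ω).widthSeq, hW.comp hw,
    ae_of_ae_map hw.aemeasurable hlim, hdich⟩
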